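/- For $n\ge 0$ let $[n]=\{1,\dots,n\}$. A family $\mathcal G\subseteq 2^{[n]}$ is a (weak) copy of a finite poset $P$ if there is a bijection $\phi:P\to\mathcal G$ with $\phi(x)\subseteq\phi(y)$ whenever $x\le_P y$; a family $\mathcal F\subseteq 2^{[n]}$ is $P$-free if no subfamily of $\mathcal F$ is a copy of $P$. For finite posets $P,Q$ with $P$ nonempty, let $La(n,P,Q)$ be the maximum, over all $P$-free families $\mathcal F\subseteq 2^{[n]}$, of the number of subfamilies of $\mathcal F$ that are copies of $Q$. Let $P_m$ be the totally ordered set with $m$ elements ($P_0$ is the empty poset, which has exactly one copy, the empty subfamily, in every family). The height of a poset is the number of elements of its longest chain. Let $k\ge 0$ be an integer. All asymptotic notation is for $n\to\infty$, with implied constants that may depend on $P$ and $k$ but not on $n$. (i) Let $P$ be a finite nonempty poset of height $l>k$. Then $$La(n,P,P_k)=\Theta\bigl(La(n,P_{k+1},P_k)\bigr).$$ Moreover, for every $n\ge 0$, $$La(n,P_{k+1},P_k)\le La(n,P,P_k)\le La(n,P_{|P|},P_k)\le\binom{|P|-1}{k}La(n,P_{k+1},P_k).$$ (ii) Let $P$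 be a finite nonempty poset of height $l\le k$. Then $$La(n,P,P_k)=O\bigl(n^{2k-1/2}\,La(n,P_l,P_{l-1})\bigr).$$ Moreover, for every integer $l$ with $1\le l\le k$ there exists a finite poset $P$ of height $l$ such that $$La(n,P,P_k)=\Theta\bigl(La(n,P_l,P_{l-1})\bigr).$$ -/

import Mathlib

open Filter Asymptotics

noncomputable section

/-- The family `G` of subsets of `[n]` is a (weak) copy of the poset `P`: there is a bijection
`φ : P → G` such that `φ x ⊆ φ y` whenever `x ≤ y` in `P`. -/
def IsCopy (P : Type*) [PartialOrder P] {n : ℕ} (G : Finset (Finset (Fin n))) : Prop :=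
  ∃ φ : P ≃ {A : Finset (Fin n) // A ∈ G}, ∀ x y : P, x ≤ y → (φ x).1 ⊆ (φ y).1

/-- The family `F` is `P`-free: no subfamily of `F` is a copy of `P`. -/
def IsPosetFree (P : Type*) [PartialOrder P] {n : ℕ} (F : Finset (Finset (Fin n))) : Prop :=
  ∀ G : Finset (Finset (Fin n)), G ⊆ F → ¬ IsCopy P G

open Classical in
/-- The number `c(Q, F)` of copies of `Q` in `F`, i.e. of subfamilies of `F` that are copies
of `Q`. -/
def copyCount (Q : Type*) [PartialOrder Q] {n : ℕ} (F : Finset (Finset (Fin n))) : ℕ :=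
  (F.powerset.filter fun G => IsCopy Q G).card

open Classical in
/-- `La(n, P, Q)`: the maximum number of copies of `Q` in a `P`-free family of subsets of `[n]`.
For nonempty `P` the empty family is `P`-free, so this is a maximum over a nonempty set. -/
def La (n : ℕ) (P Q : Type*) [PartialOrder P] [PartialOrder Q] : ℕ :=
  ((Finset.univ : Finset (Finset (Finset (Fin n)))).filter fun F => IsPosetFree P F).sup
    fun F => copyCount Q F

/-- The poset `P` has height `l`: its longest chains have exactly `l` elements. -/
def HasHeight (P : Type*) [PartialOrder P] (l : ℕ) : Prop :=
  (Set.univ : Set P).chainHeight (· ≤ ·) = (l : ℕ∞)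

end

/-! Copies of `Fin k` are `k`-chains. When the height exceeds `k`, split a `P_p`-free family with `p
= |P|` into `p - 1` antichains by rank: each `k`-chain meets `k` of them, and any `k` of them form a
`P_{k+1}`-free family (`card_chainsOf_le`). The other comparisons hold because a linear extension of
`P` is a chain of `|P|` elements and `P` contains a chain of `k + 1` elements.

For height `l = q + 1 ≤ k` the yardstick is the largest multinomial coefficient with `q + 1` parts.
It agrees with `La(n, P_{q+1}, P_q)` up to constants: a LYM argument on chains coded as ordered
partitions gives one side (`La_le_maxMultinomial`), and a union of `q` levels gives the other
(`maxMultinomial_le_La`). It is also at least `(q + 1)^n / (n + 1)^(q + 1)`. Conversely, a `P`-free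
family has no tower of `q + 1` large layers, so cutting its chains recursively where the layers fill
up leaves `O(n^q (q + 1)^n)` chains of any length (`card_chainsAbove_le`). The quotient is `O(n^(2l
- 1))`.

The order `La(n, P_l, P_{l-1})` is attained by a broom, a chain of `q` elements below an antichain:
being broom-free leaves boundedly many ways to extend a `q`-chain upwards, and adding a few large
nested sets to `q` levels creates long chains but no broom. -/

/-! ### Copies of path posets as chains of sets. -/

section ChainsAndCopies

variable {n : ℕ}

open Classical in
/-- The chains of `k` members in the family `F`. -/
noncomputable def chainsOf (k : ℕ) (F : Finset (Finset (Fin n))) :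
    Finset (Finset (Finset (Fin n))) :=
  (F.powersetCard k).filter fun G => IsChain (· ⊆ ·) (G : Set (Finset (Fin n)))

theorem mem_chainsOf {k : ℕ} {F G : Finset (Finset (Fin n))} :
    G ∈ chainsOf k F ↔ G ⊆ F ∧ G.card = k ∧ IsChain (· ⊆ ·) (G : Set (Finset (Fin n))) := by
  simp [chainsOf, Finset.mem_powersetCard, and_assoc]

theorem isCopy_iff_exists_injective {P : Type*} [PartialOrder P] {G : Finset (Finset (Fin n))} :
    IsCopy P G ↔ ∃ φ : P → Finset (Fin n), Function.Injective φ ∧ Monotone φ ∧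
      Set.range φ = (G : Set (Finset (Fin n))) := by
  constructor
  · rintro ⟨φ, hφ⟩
    refine ⟨fun x => (φ x).1, Subtype.val_injective.comp φ.injective, fun x y h => hφ x y h, ?_⟩
    ext A
    constructor
    · rintro ⟨x, rfl⟩
      exact (φ x).2
    · intro hA
      exact ⟨φ.symm ⟨A, hA⟩, by simp⟩
  · rintro ⟨φ, hi, hm, hr⟩
    have hmem : ∀ x, φ x ∈ G := fun x => by
      have : φ x ∈ (G : Set (Finset (Fin n))) := hr ▸ Set.mem_range_self x
      exact this
    refine ⟨Equiv.ofBijective (fun x => ⟨φ x, hmem x⟩) ⟨?_, ?_⟩, fun x y h => hm h⟩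
    · intro x y h
      exact hi (congrArg Subtype.val h)
    · rintro ⟨A, hA⟩
      have : A ∈ Set.range φ := by rw [hr]; exact hA
      obtain ⟨x, rfl⟩ := this
      exact ⟨x, rfl⟩

/-- A poset-free family admits no injective monotone map from the poset. -/
theorem isPosetFree_iff {P : Type*} [PartialOrder P] [Finite P] {F : Finset (Finset (Fin n))} :
    IsPosetFree P F ↔
      ∀ φ : P → Finset (Fin n), Function.Injective φ → Monotone φ → ¬ ∀ x, φ x ∈ F := by
  constructor
  · intro h φ hi hm hF
    have hfin := Set.finite_range φ
    refine h hfin.toFinset ?_ (isCopy_iff_exists_injective.2 ⟨φ, hi, hm, by simp⟩)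
    intro A hA
    obtain ⟨x, rfl⟩ := hfin.mem_toFinset.1 hA
    exact hF x
  · intro h G hG hc
    obtain ⟨φ, hi, hm, hr⟩ := isCopy_iff_exists_injective.1 hc
    refine h φ hi hm fun x => hG ?_
    have : φ x ∈ (G : Set (Finset (Fin n))) := hr ▸ Set.mem_range_self x
    exact this

/-- A finite chain of sets, listed in increasing order. -/
theorem exists_monotone_enum {k : ℕ} {G : Finset (Finset (Fin n))} (hk : G.card = k)
    (hG : IsChain (· ⊆ ·) (G : Set (Finset (Fin n)))) :
    ∃ φ : Fin k → Finset (Fin n), Function.Injective φ ∧ Monotone φ ∧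
      Set.range φ = (G : Set (Finset (Fin n))) := by
  classical
  -- `e` is the identity; it only forgets the linear order. On a chain that order agrees with
  -- inclusion.
  let e : LinearExtension {A // A ∈ G} → {A // A ∈ G} := fun x => x
  let _ : Fintype (LinearExtension {A // A ∈ G}) :=
    inferInstanceAs (Fintype {A // A ∈ G})
  have hc : Fintype.card (LinearExtension {A // A ∈ G}) = k := by
    rw [← hk, ← Fintype.card_coe G]; rfl
  let o := Fintype.orderIsoFinOfCardEq (LinearExtension {A // A ∈ G}) hc
  refine ⟨fun i => (e (o i)).1, ?_, ?_, ?_⟩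
  · intro i j h
    exact o.injective (Subtype.ext h)
  · intro i j h
    rcases hG.total (e (o i)).2 (e (o j)).2 with h' | h'
    · exact h'
    · have h1 : o j ≤ o i :=
        (toLinearExtension (α := {A // A ∈ G})).monotone (a := e (o j)) (b := e (o i)) h'
      have h2 : o i = o j := le_antisymm (o.monotone h) h1
      exact (congrArg (fun x => (e x).1) h2).subset
  · ext A
    constructor
    · rintro ⟨i, rfl⟩
      exact (e (o i)).2
    · intro hA
      refine ⟨o.symm (show LinearExtension {A // A ∈ G} from ⟨A, hA⟩), ?_⟩
      exact congrArg (fun x => (e x).1) (o.apply_symm_apply _)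

theorem isCopy_fin_iff {k : ℕ} {G : Finset (Finset (Fin n))} :
    IsCopy (Fin k) G ↔ G.card = k ∧ IsChain (· ⊆ ·) (G : Set (Finset (Fin n))) := by
  rw [isCopy_iff_exists_injective]
  constructor
  · rintro ⟨φ, hi, hm, hr⟩
    constructor
    · rw [← Set.ncard_coe_finset, ← hr, ← Set.image_univ, Set.ncard_image_of_injective _ hi]
      simp
    · rw [← hr]
      rintro _ ⟨i, rfl⟩ _ ⟨j, rfl⟩ -
      exact (le_total i j).imp (fun h => hm h) (fun h => hm h)
  · rintro ⟨h1, h2⟩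
    exact exists_monotone_enum h1 h2

theorem copyCount_fin (k : ℕ) (F : Finset (Finset (Fin n))) :
    copyCount (Fin k) F = (chainsOf k F).card := by
  classical
  unfold copyCount
  congr 1
  ext G
  simp [mem_chainsOf, isCopy_fin_iff]

theorem isPosetFree_fin_iff {k : ℕ} {F : Finset (Finset (Fin n))} :
    IsPosetFree (Fin k) F ↔
      ∀ G ⊆ F, IsChain (· ⊆ ·) (G : Set (Finset (Fin n))) → G.card < k := by
  constructor
  · intro h G hG hc
    by_contra! hk
    obtain ⟨G', hG', hk'⟩ := Finset.exists_subset_card_eq hk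
    exact h G' (hG'.trans hG) (isCopy_fin_iff.2 ⟨hk', hc.mono (by exact_mod_cast hG')⟩)
  · intro h G hG hc
    obtain ⟨h1, h2⟩ := isCopy_fin_iff.1 hc
    exact absurd (h G hG h2) (by omega)

theorem copyCount_le_La (P Q : Type*) [PartialOrder P] [PartialOrder Q]
    {F : Finset (Finset (Fin n))} (hF : IsPosetFree P F) : copyCount Q F ≤ La n P Q := by
  classical
  exact Finset.le_sup (f := fun F => copyCount Q F) (by simp [hF])

theorem La_le {P Q : Type*} [PartialOrder P] [PartialOrder Q] {b : ℕ}
    (h : ∀ F : Finset (Finset (Fin n)), IsPosetFree P F → copyCount Q F ≤ b) : La n P Q ≤ b := by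
  classical
  refine Finset.sup_le fun F hF => h F ?_
  simpa using hF

/-- A family free of `P` is free of the chain on `|P|` elements, a linear extension of `P`. -/
theorem IsPosetFree.fin_card {P : Type*} [PartialOrder P] [Fintype P]
    {F : Finset (Finset (Fin n))} (hF : IsPosetFree P F) : IsPosetFree (Fin (Fintype.card P)) F := by
  let _ : Fintype (LinearExtension P) := inferInstanceAs (Fintype P)
  let o := Fintype.orderIsoFinOfCardEq (LinearExtension P) (k := Fintype.card P)
    (Fintype.card_congr (Equiv.refl P))
  rw [isPosetFree_iff] at hF ⊢
  intro φ hi hm hφ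
  refine hF (fun x => φ (o.symm (toLinearExtension x)))
    (hi.comp (o.symm.injective.comp fun x y h => h))
    (hm.comp (o.symm.monotone.comp toLinearExtension.monotone)) fun x => hφ _

/-- A family without chains of `k` members is free of every poset that has a chain of `k` elements. -/
theorem IsPosetFree.of_chain {P : Type*} [PartialOrder P] [Finite P] {k : ℕ}
    {F : Finset (Finset (Fin n))} (hF : IsPosetFree (Fin k) F) {c : Finset P} (hk : k ≤ c.card)
    (hc : IsChain (· ≤ ·) (c : Set P)) : IsPosetFree P F := by
  classical
  rw [isPosetFree_iff]
  intro φ hi hm hφ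
  have := isPosetFree_fin_iff.1 hF (c.image φ) (by
    intro A hA
    obtain ⟨x, -, rfl⟩ := Finset.mem_image.1 hA
    exact hφ x) (by
    rw [Finset.coe_image]
    rintro _ ⟨x, hx, rfl⟩ _ ⟨y, hy, rfl⟩ -
    exact (hc.total hx hy).imp (fun h => hm h) (fun h => hm h))
  rw [Finset.card_image_of_injective _ hi] at this
  omega

end ChainsAndCopies

/-! ### Rank functions and height. -/

section Rank

/-- A finite poset whose chains have at most `l` elements has a strictly monotone rank function
with `l` values. -/
theorem exists_rank {α : Type*} [PartialOrder α] [Finite α] {l : ℕ}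
    (h : ∀ c : Finset α, IsChain (· ≤ ·) (c : Set α) → c.card ≤ l) :
    ∃ f : α → ℕ, StrictMono f ∧ ∀ x, f x < l := by
  classical
  have := Fintype.ofFinite α
  -- The rank of `x` is the largest size of a chain strictly below `x`. Adjoining `x` makes it
  -- strictly monotone, and not counting `x` keeps it below `l`.
  let below : α → Finset (Finset α) := fun x =>
    Finset.univ.filter fun c => IsChain (· ≤ ·) (c : Set α) ∧ ∀ y ∈ c, y < x
  have hins : ∀ x, ∀ c ∈ below x, x ∉ c ∧ IsChain (· ≤ ·) (↑(insert x c) : Set α) := by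
    intro x c hc
    simp only [below, Finset.mem_filter, Finset.mem_univ, true_and] at hc
    refine ⟨fun hx => lt_irrefl _ (hc.2 x hx), ?_⟩
    rw [Finset.coe_insert]
    exact hc.1.insert fun y hy _ => Or.inr (hc.2 y hy).le
  refine ⟨fun x => (below x).sup Finset.card, ?_, ?_⟩
  · intro x y hxy
    have hne : (below x).Nonempty := ⟨∅, by simp [below]⟩
    obtain ⟨c, hc, hce⟩ := Finset.exists_mem_eq_sup (below x) hne Finset.card
    have hc' := hins x c hc
    simp only [below, Finset.mem_filter, Finset.mem_univ, true_and] at hc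
    have : insert x c ∈ below y := by
      simp only [below, Finset.mem_filter, Finset.mem_univ, true_and]
      refine ⟨hc'.2, fun z hz => ?_⟩
      rcases Finset.mem_insert.1 hz with rfl | hz
      · exact hxy
      · exact (hc.2 z hz).trans hxy
    have h2 := Finset.le_sup (f := Finset.card) this
    rw [Finset.card_insert_of_notMem hc'.1] at h2
    show (below x).sup Finset.card < (below y).sup Finset.card
    omega
  · intro x
    have hne : (below x).Nonempty := ⟨∅, by simp [below]⟩
    obtain ⟨c, hc, hce⟩ := Finset.exists_mem_eq_sup (below x) hne Finset.card
    have hc' := hins x c hc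
    have := h _ hc'.2
    rw [Finset.card_insert_of_notMem hc'.1] at this
    show (below x).sup Finset.card < l
    omega

theorem HasHeight.card_le {P : Type*} [PartialOrder P] {l : ℕ} (h : HasHeight P l)
    {c : Finset P} (hc : IsChain (· ≤ ·) (c : Set P)) : c.card ≤ l := by
  have := Set.encard_le_chainHeight_of_isChain Set.univ (c : Set P) (Set.subset_univ _) hc
  unfold HasHeight at h
  rw [h, Set.encard_coe_eq_coe_finsetCard] at this
  exact_mod_cast this

theorem HasHeight.exists_chain {P : Type*} [PartialOrder P] {l : ℕ} (h : HasHeight P l) :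
    ∃ c : Finset P, IsChain (· ≤ ·) (c : Set P) ∧ c.card = l := by
  obtain ⟨t, -, ht, hc⟩ := Set.exists_isChain_of_le_chainHeight (s := (Set.univ : Set P))
    (r := (· ≤ ·)) l (by rw [← h])
  have hfin : t.Finite := Set.finite_of_encard_eq_coe ht
  refine ⟨hfin.toFinset, by simpa using hc, ?_⟩
  rw [hfin.encard_eq_coe_toFinset_card] at ht
  exact_mod_cast ht

theorem hasHeight_of {P : Type*} [PartialOrder P] {l : ℕ} [Finite P]
    (h : ∀ c : Finset P, IsChain (· ≤ ·) (c : Set P) → c.card ≤ l)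
    {c : Finset P} (hc : IsChain (· ≤ ·) (c : Set P)) (hl : c.card = l) : HasHeight P l := by
  unfold HasHeight
  apply le_antisymm
  · obtain ⟨t, -, ht, htc⟩ := Set.exists_eq_chainHeight_of_finite (Set.univ : Set P) (· ≤ ·)
      (Set.toFinite _)
    rw [← ht, (Set.toFinite t).encard_eq_coe_toFinset_card]
    exact_mod_cast h _ (by simpa using htc)
  · have := Set.encard_le_chainHeight_of_isChain Set.univ (c : Set P) (Set.subset_univ _) hc
    rwa [Set.encard_coe_eq_coe_finsetCard, hl] at this

end Rank

/-! ### Posets of height greater than `k`. -/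

section LargeHeight

variable {n : ℕ}

/-- Rank is injective on chains, so a `k`-chain uses a `k`-set `S` of the `p - 1` ranks, and the
members with rank in `S` contain no chain of `k + 1` sets. The bound sums over `S`. -/
theorem card_chainsOf_le (p k : ℕ) {F : Finset (Finset (Fin n))}
    (hF : IsPosetFree (Fin p) F) :
    (chainsOf k F).card ≤ (p - 1).choose k * La n (Fin (k + 1)) (Fin k) := by
  classical
  have hF' := isPosetFree_fin_iff.1 hF
  obtain ⟨f, hf, hfl⟩ := exists_rank (α := {A // A ∈ F}) (l := p - 1) (by
    intro c hc
    have := hF' (c.map (Function.Embedding.subtype _)) (by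
      intro A hA
      obtain ⟨x, -, rfl⟩ := Finset.mem_map.1 hA
      exact x.2) (by
      rw [Finset.coe_map]
      rintro _ ⟨x, hx, rfl⟩ _ ⟨y, hy, rfl⟩ -
      exact hc.total hx hy)
    rw [Finset.card_map] at this
    omega)
  -- The default `0` off `F` plays no role.
  let g : Finset (Fin n) → ℕ := fun A => if h : A ∈ F then f ⟨A, h⟩ else 0
  have hg : ∀ A ∈ F, ∀ B ∈ F, A ⊂ B → g A < g B := by
    intro A hA B hB hAB
    simp only [g, hA, hB, dif_pos]
    exact hf (show (⟨A, hA⟩ : {A // A ∈ F}) < ⟨B, hB⟩ from hAB)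
  have hgl : ∀ A ∈ F, g A < p - 1 := by
    intro A hA
    simp only [g, hA, dif_pos]
    exact hfl _
  have hinj : ∀ G ⊆ F, IsChain (· ⊆ ·) (G : Set (Finset (Fin n))) →
      Set.InjOn g (G : Set (Finset (Fin n))) := by
    intro G hG hc A hA B hB hAB
    by_contra hne
    rcases hc.total hA hB with h | h
    · exact absurd (hg A (hG hA) B (hG hB) (h.ssubset_of_ne hne)) (by omega)
    · exact absurd (hg B (hG hB) A (hG hA) (h.ssubset_of_ne (Ne.symm hne))) (by omega)
  have hcover : chainsOf k F ⊆ ((Finset.range (p - 1)).powersetCard k).biUnion fun S =>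
      chainsOf k (F.filter fun A => g A ∈ S) := by
    intro G hG
    obtain ⟨h1, h2, h3⟩ := mem_chainsOf.1 hG
    refine Finset.mem_biUnion.2 ⟨G.image g, ?_, ?_⟩
    · rw [Finset.mem_powersetCard, Finset.card_image_of_injOn (hinj G h1 h3)]
      refine ⟨fun i hi => ?_, h2⟩
      obtain ⟨A, hA, rfl⟩ := Finset.mem_image.1 hi
      exact Finset.mem_range.2 (hgl A (h1 hA))
    · refine mem_chainsOf.2 ⟨fun A hA => ?_, h2, h3⟩
      exact Finset.mem_filter.2 ⟨h1 hA, Finset.mem_image_of_mem g hA⟩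
  refine (Finset.card_le_card hcover).trans ?_
  refine (Finset.card_biUnion_le_card_mul _ _ (La n (Fin (k + 1)) (Fin k)) fun S hS => ?_).trans ?_
  · rw [← copyCount_fin]
    refine copyCount_le_La _ _ (isPosetFree_fin_iff.2 fun G hG hc => ?_)
    have hGF : G ⊆ F := hG.trans (Finset.filter_subset _ _)
    rw [← Finset.card_image_of_injOn (hinj G hGF hc)]
    have : (G.image g).card ≤ S.card := Finset.card_le_card fun i hi => by
      obtain ⟨A, hA, rfl⟩ := Finset.mem_image.1 hi
      exact (Finset.mem_filter.1 (hG hA)).2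
    rw [(Finset.mem_powersetCard.1 hS).2] at this
    omega
  · simp

theorem La_fin_le (p k : ℕ) :
    La n (Fin p) (Fin k) ≤ (p - 1).choose k * La n (Fin (k + 1)) (Fin k) :=
  La_le fun F hF => by
    rw [copyCount_fin]
    exact card_chainsOf_le p k hF

theorem La_le_La_card (P Q : Type*) [PartialOrder P] [PartialOrder Q] [Fintype P] :
    La n P Q ≤ La n (Fin (Fintype.card P)) Q :=
  La_le fun _ hF => copyCount_le_La _ _ hF.fin_card

theorem La_chain_le_La {P : Type*} (Q : Type*) [PartialOrder P] [PartialOrder Q] [Finite P]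
    {k l : ℕ} (hP : HasHeight P l) (hkl : k < l) : La n (Fin (k + 1)) Q ≤ La n P Q := by
  obtain ⟨c, hc, hcl⟩ := hP.exists_chain
  exact La_le fun F hF => copyCount_le_La _ _ (hF.of_chain (c := c) (by omega) hc)

end LargeHeight

/-! ### The largest multinomial coefficient and the LYM upper bound. -/

section Multinomial

variable {n q : ℕ}

/-- The number of functions `Fin n → Fin (q + 1)` with prescribed fiber sizes. -/
def fiberTypeCount (n q : ℕ) (t : Fin (q + 1) → ℕ) : ℕ :=
  (Finset.univ.filter fun g : Fin n → Fin (q + 1) =>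
    ∀ j, (Finset.univ.filter fun x => g x = j).card = t j).card

/-- The largest multinomial coefficient `n! / (t₀! ⋯ t_q!)`. -/
def maxMultinomial (n q : ℕ) : ℕ :=
  (Finset.univ : Finset (Fin n → Fin (q + 1))).sup fun g =>
    fiberTypeCount n q fun j => (Finset.univ.filter fun x => g x = j).card

theorem fiberTypeCount_le (t : Fin (q + 1) → ℕ) : fiberTypeCount n q t ≤ maxMultinomial n q := by
  rcases Finset.eq_empty_or_nonempty (Finset.univ.filter fun g : Fin n → Fin (q + 1) =>
    ∀ j, (Finset.univ.filter fun x => g x = j).card = t j) with h | ⟨g, hg⟩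
  · unfold fiberTypeCount
    rw [h]
    exact Nat.zero_le _
  · have ht : t = fun j => (Finset.univ.filter fun x => g x = j).card :=
      funext fun j => ((Finset.mem_filter.1 hg).2 j).symm
    rw [ht]
    exact Finset.le_sup (f := fun g : Fin n → Fin (q + 1) =>
      fiberTypeCount n q fun j => (Finset.univ.filter fun x => g x = j).card) (Finset.mem_univ g)

theorem exists_fiberTypeCount_eq (n q : ℕ) : ∃ g : Fin n → Fin (q + 1),
    (fiberTypeCount n q fun j => (Finset.univ.filter fun x => g x = j).card) =
      maxMultinomial n q := by
  obtain ⟨g, -, hg⟩ := Finset.exists_mem_eq_sup (Finset.univ : Finset (Fin n → Fin (q + 1)))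
    ⟨fun _ => 0, Finset.mem_univ _⟩ fun g =>
      fiberTypeCount n q fun j => (Finset.univ.filter fun x => g x = j).card
  exact ⟨g, hg.symm⟩

/-- Pigeonhole: there are at most `(n + 1)^(q + 1)` vectors of fiber sizes. -/
theorem pow_le_maxMultinomial (n q : ℕ) :
    (q + 1) ^ n ≤ (n + 1) ^ (q + 1) * maxMultinomial n q := by
  let f : (Fin n → Fin (q + 1)) → Fin (q + 1) → Fin (n + 1) := fun g j =>
    ⟨(Finset.univ.filter fun x => g x = j).card,
      Nat.lt_succ_of_le ((Finset.card_le_univ _).trans (by simp))⟩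
  have h := Finset.card_le_mul_card_image_of_maps_to
    (s := (Finset.univ : Finset (Fin n → Fin (q + 1))))
    (t := (Finset.univ : Finset (Fin (q + 1) → Fin (n + 1)))) (f := f)
    (fun _ _ => Finset.mem_univ _) (maxMultinomial n q) (fun t _ => by
      refine le_trans (le_of_eq ?_) (fiberTypeCount_le (fun j => (t j : ℕ)))
      unfold fiberTypeCount
      congr 1
      ext g
      simp only [Finset.mem_filter, Finset.mem_univ, true_and, f, funext_iff, Fin.ext_iff])
  simpa [mul_comm] using h

/-- Classify the functions by their value `i` at `0`; deleting that coordinate is injective on each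
class and lowers only the size of fiber `i`, by one. -/
theorem maxMultinomial_succ_le (n q : ℕ) :
    maxMultinomial (n + 1) q ≤ (q + 1) * maxMultinomial n q := by
  classical
  obtain ⟨g₀, ht⟩ := exists_fiberTypeCount_eq (n + 1) q
  set t := fun j => (Finset.univ.filter fun x => g₀ x = j).card
  rw [← ht, fiberTypeCount, mul_comm]
  have h := Finset.card_le_mul_card_image_of_maps_to
    (s := Finset.univ.filter fun g : Fin (n + 1) → Fin (q + 1) =>
      ∀ j, (Finset.univ.filter fun x => g x = j).card = t j)
    (t := (Finset.univ : Finset (Fin (q + 1)))) (f := fun g => g 0)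
    (fun _ _ => Finset.mem_univ _) (maxMultinomial n q) (fun i _ => by
      refine le_trans ?_ (fiberTypeCount_le (fun j => t j - if i = j then 1 else 0))
      unfold fiberTypeCount
      refine Finset.card_le_card_of_injOn Fin.tail ?_ ?_
      · intro g hg
        simp only [Finset.coe_filter, Finset.mem_filter, Finset.mem_univ, true_and,
          Set.mem_ofPred_eq] at hg ⊢
        intro j
        rw [← hg.1 j, Fin.card_filter_univ_succ', hg.2]
        rw [Nat.add_sub_cancel_left]
        congr!
      · intro g hg g' hg' h
        simp only [Finset.coe_filter, Finset.mem_filter, Finset.mem_univ, true_and,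
          Set.mem_ofPred_eq] at hg hg'
        rw [← Fin.cons_self_tail g, ← Fin.cons_self_tail g', h, hg.2, hg'.2])
  simpa using h

theorem maxMultinomial_add_le (n q c : ℕ) :
    maxMultinomial (n + c) q ≤ (q + 1) ^ c * maxMultinomial n q := by
  induction c with
  | zero => simp
  | succ c ih =>
    calc maxMultinomial (n + c + 1) q ≤ (q + 1) * maxMultinomial (n + c) q :=
          maxMultinomial_succ_le _ _
      _ ≤ (q + 1) * ((q + 1) ^ c * maxMultinomial n q) := Nat.mul_le_mul_left _ ih
      _ = _ := by ring

open Classical in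
/-- The number of permutations that sort `g`. -/
noncomputable def sortingCount (g : Fin n → Fin (q + 1)) : ℕ :=
  (Finset.univ.filter fun σ : Equiv.Perm (Fin n) => Monotone (g ∘ σ)).card

theorem sortingCount_pos (g : Fin n → Fin (q + 1)) : 0 < sortingCount g :=
  Finset.card_pos.2 ⟨Tuple.sort g, by simp [Tuple.monotone_sort]⟩

theorem sortingCount_comp (g : Fin n → Fin (q + 1)) (τ : Equiv.Perm (Fin n)) :
    sortingCount (g ∘ τ) = sortingCount g := by
  unfold sortingCount
  refine Finset.card_equiv (Equiv.mulLeft τ) fun σ => ?_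
  simp only [Finset.mem_filter, Finset.mem_univ, true_and, Equiv.coe_mulLeft, Equiv.Perm.coe_mul,
    Function.comp_assoc]

theorem exists_perm_of_card_fiber_eq {g g' : Fin n → Fin (q + 1)}
    (h : ∀ j, (Finset.univ.filter fun x => g x = j).card =
      (Finset.univ.filter fun x => g' x = j).card) : ∃ τ : Equiv.Perm (Fin n), g' ∘ τ = g := by
  have e : ∀ j, Nonempty ({x // g x = j} ≃ {x // g' x = j}) := fun j =>
    Fintype.card_eq.1 (by rw [Fintype.card_subtype, Fintype.card_subtype, h j])
  exact ⟨Equiv.ofFiberEquiv fun j => (e j).some, funext fun x => Equiv.ofFiberEquiv_map _ x⟩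

theorem sortingCount_congr {g g' : Fin n → Fin (q + 1)}
    (h : ∀ j, (Finset.univ.filter fun x => g x = j).card =
      (Finset.univ.filter fun x => g' x = j).card) : sortingCount g = sortingCount g' := by
  obtain ⟨τ, rfl⟩ := exists_perm_of_card_fiber_eq h
  exact sortingCount_comp g' τ

/-- Every permutation sorts some rearrangement of `g`, and all rearrangements are sorted by equally
many permutations. -/
theorem factorial_le_mul_sortingCount (g : Fin n → Fin (q + 1)) :
    Fintype.card (Equiv.Perm (Fin n)) ≤ maxMultinomial n q * sortingCount g := by
  classical
  let T := Finset.univ.filter fun g' : Fin n → Fin (q + 1) =>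
    ∀ j, (Finset.univ.filter fun x => g' x = j).card = (Finset.univ.filter fun x => g x = j).card
  have hcover : (Finset.univ : Finset (Equiv.Perm (Fin n))) ⊆ T.biUnion fun g' =>
      Finset.univ.filter fun σ : Equiv.Perm (Fin n) => Monotone (g' ∘ σ) := by
    intro σ _
    refine Finset.mem_biUnion.2 ⟨g ∘ (Tuple.sort g * σ⁻¹ : Equiv.Perm (Fin n)), ?_, ?_⟩
    · refine Finset.mem_filter.2 ⟨Finset.mem_univ _, fun j => ?_⟩
      exact Finset.card_equiv (Tuple.sort g * σ⁻¹) fun x => by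
        rw [Finset.mem_filter, Finset.mem_filter]
        simp
    · refine Finset.mem_filter.2 ⟨Finset.mem_univ _, ?_⟩
      have : (g ∘ (Tuple.sort g * σ⁻¹ : Equiv.Perm (Fin n))) ∘ σ = g ∘ Tuple.sort g := by
        ext x; simp
      rw [this]
      exact Tuple.monotone_sort g
  calc Fintype.card (Equiv.Perm (Fin n)) ≤ _ := Finset.card_le_card hcover
    _ ≤ T.card * sortingCount g := Finset.card_biUnion_le_card_mul _ _ _ fun g' hg' =>
        (sortingCount_congr (Finset.mem_filter.1 hg').2).le
    _ ≤ _ := Nat.mul_le_mul_right _ (fiberTypeCount_le _)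

/-- A LYM-type inequality: if every permutation sorts at most one member of `𝒢`, then `𝒢` has at
most as many members as the largest multinomial coefficient. -/
theorem card_le_maxMultinomial (𝒢 : Finset (Fin n → Fin (q + 1)))
    (h : ∀ σ : Equiv.Perm (Fin n), ∀ g ∈ 𝒢, ∀ g' ∈ 𝒢, Monotone (g ∘ σ) → Monotone (g' ∘ σ) →
      g = g') : 𝒢.card ≤ maxMultinomial n q := by
  classical
  rcases 𝒢.eq_empty_or_nonempty with rfl | hne
  · simp
  -- With `s` the least sorting count in `𝒢`, the disjoint sets of sorting permutations give `|𝒢| s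
  -- ≤ n!`, while `n!` is at most the multinomial maximum times `s`.
  obtain ⟨g, hg, hmin⟩ := Finset.exists_min_image 𝒢 sortingCount hne
  refine Nat.le_of_mul_le_mul_right ?_ (sortingCount_pos g)
  refine le_trans ?_ (factorial_le_mul_sortingCount g)
  calc 𝒢.card * sortingCount g = ∑ _g' ∈ 𝒢, sortingCount g := by simp
    _ ≤ ∑ g' ∈ 𝒢, sortingCount g' := Finset.sum_le_sum hmin
    _ = (𝒢.biUnion fun g' =>
          Finset.univ.filter fun σ : Equiv.Perm (Fin n) => Monotone (g' ∘ σ)).card := by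
        rw [Finset.card_biUnion]
        · rfl
        · intro g1 h1 g2 h2 hne
          rw [Function.onFun, Finset.disjoint_left]
          intro σ hσ1 hσ2
          exact hne (h σ g1 h1 g2 h2 (Finset.mem_filter.1 hσ1).2 (Finset.mem_filter.1 hσ2).2)
    _ ≤ _ := Finset.card_le_univ _

/-- The index of the gap of the chain `G` in which the point `x` lies. -/
def chainCode (q : ℕ) (G : Finset (Finset (Fin n))) (x : Fin n) : Fin (q + 1) :=
  Fin.ofNat (q + 1) (G.filter fun A => x ∉ A).card

theorem chainCode_val {G : Finset (Finset (Fin n))} (hG : G.card = q) (x : Fin n) :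
    (chainCode q G x : ℕ) = (G.filter fun A => x ∉ A).card := by
  have : (G.filter fun A => x ∉ A).card ≤ G.card := Finset.card_filter_le _ _
  simp only [chainCode, Fin.val_ofNat]
  exact Nat.mod_eq_of_lt (by omega)

/-- The members of `G` that omit `x` form an initial segment of the chain: if `x ∈ A` they all lie
properly below `A`, and if `x ∉ A` they include every member contained in `A`. -/
theorem mem_iff_chainCode_lt {G : Finset (Finset (Fin n))} (hG : G.card = q)
    (hc : IsChain (· ⊆ ·) (G : Set (Finset (Fin n)))) {A : Finset (Fin n)} (hA : A ∈ G)
    (x : Fin n) : x ∈ A ↔ (chainCode q G x : ℕ) < (G.filter fun B => B ⊆ A).card := by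
  rw [chainCode_val hG]
  constructor
  · intro hx
    refine Finset.card_lt_card ((Finset.ssubset_iff_of_subset fun B hB => ?_).2
      ⟨A, by simp [hA], by simp [hx]⟩)
    obtain ⟨hB, hxB⟩ := Finset.mem_filter.1 hB
    refine Finset.mem_filter.2 ⟨hB, ?_⟩
    rcases hc.total hB hA with h | h
    · exact h
    · exact absurd (h hx) hxB
  · intro h
    by_contra hx
    refine absurd (Finset.card_le_card fun B hB => ?_) (not_le.2 h)
    obtain ⟨hB, hBA⟩ := Finset.mem_filter.1 hB
    exact Finset.mem_filter.2 ⟨hB, fun hxB => hx (hBA hxB)⟩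

/-- The `r`-th smallest member of a chain is the set of points with code below `r`, so the code
determines the chain. -/
theorem chainCode_injOn (q : ℕ) (F : Finset (Finset (Fin n))) :
    Set.InjOn (chainCode q) (chainsOf q F : Set (Finset (Finset (Fin n)))) := by
  have key : ∀ G ∈ chainsOf q F, ∀ G' ∈ chainsOf q F, chainCode q G = chainCode q G' →
      G ⊆ G' := by
    intro G hG G' hG' h A hA
    obtain ⟨-, h2, h3⟩ := mem_chainsOf.1 hG
    obtain ⟨-, h2', h3'⟩ := mem_chainsOf.1 hG'
    obtain ⟨φ, hi, hm, hr⟩ := exists_monotone_enum h2' h3'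
    set r := (G.filter fun B => B ⊆ A).card with hrdef
    have hr1 : 0 < r := Finset.card_pos.2 ⟨A, by simp [hA]⟩
    have hr2 : r ≤ q := h2 ▸ Finset.card_filter_le _ _
    have hmem : ∀ i, φ i ∈ G' := fun i => by
      have : φ i ∈ (G' : Set (Finset (Fin n))) := hr ▸ Set.mem_range_self i
      exact this
    have hφ : (G'.filter fun B => B ⊆ φ ⟨r - 1, by omega⟩).card = r := by
      have : G'.filter (fun B => B ⊆ φ ⟨r - 1, by omega⟩) =
          (Finset.Iic (⟨r - 1, by omega⟩ : Fin q)).image φ := by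
        ext B
        simp only [Finset.mem_filter, Finset.mem_image, Finset.mem_Iic]
        constructor
        · rintro ⟨hB, hBs⟩
          have : B ∈ Set.range φ := by rw [hr]; exact hB
          obtain ⟨i, rfl⟩ := this
          refine ⟨i, ?_, rfl⟩
          by_contra hlt
          exact absurd (hi (hBs.antisymm (hm (not_le.1 hlt).le))) (not_le.1 hlt).ne'
        · rintro ⟨i, hile, rfl⟩
          exact ⟨hmem i, hm hile⟩
      rw [this, Finset.card_image_of_injective _ hi, Fin.card_Iic]
      simp only
      omega
    have : A = φ ⟨r - 1, by omega⟩ := by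
      ext x
      rw [mem_iff_chainCode_lt h2 h3 hA, mem_iff_chainCode_lt h2' h3' (hmem _), hφ, h]
    rw [this]
    exact hmem _
  intro G hG G' hG' h
  exact (key G hG G' hG' h).antisymm (key G' hG' G hG h.symm)

/-- In a family without chains of `q + 1` members, the chains of `q` members are at most as many as
the largest multinomial coefficient. -/
theorem card_chainsOf_le_maxMultinomial {F : Finset (Finset (Fin n))}
    (hF : IsPosetFree (Fin (q + 1)) F) : (chainsOf q F).card ≤ maxMultinomial n q := by
  classical
  rw [← Finset.card_image_of_injOn (chainCode_injOn q F)]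
  refine card_le_maxMultinomial _ fun σ g hg g' hg' hσ hσ' => ?_
  obtain ⟨G, hG, rfl⟩ := Finset.mem_image.1 hg
  obtain ⟨G', hG', rfl⟩ := Finset.mem_image.1 hg'
  obtain ⟨h1, h2, h3⟩ := mem_chainsOf.1 hG
  obtain ⟨h1', h2', h3'⟩ := mem_chainsOf.1 hG'
  -- If `σ` sorts the code, each member of the chain is an initial segment of the ordering `σ`. All
  -- such segments are nested, so `G ∪ G'` is a chain; having at most `q` members, it equals both.
  have lower : ∀ G ∈ chainsOf q F, Monotone (chainCode q G ∘ σ) → ∀ A ∈ G, ∀ i j : Fin n,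
      i ≤ j → σ j ∈ A → σ i ∈ A := by
    intro G hG hσ A hA i j hij hj
    obtain ⟨-, h2, h3⟩ := mem_chainsOf.1 hG
    rw [mem_iff_chainCode_lt h2 h3 hA] at hj ⊢
    exact lt_of_le_of_lt (hσ hij) hj
  have hmem : ∀ A ∈ G ∪ G', ∀ i j : Fin n, i ≤ j → σ j ∈ A → σ i ∈ A := by
    intro A hA
    rcases Finset.mem_union.1 hA with hA | hA
    · exact lower G hG hσ A hA
    · exact lower G' hG' hσ' A hA
  have hchain : IsChain (· ⊆ ·) ((G ∪ G' : Finset (Finset (Fin n))) : Set (Finset (Fin n))) := by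
    intro A hA B hB _
    by_contra! hAB
    obtain ⟨h1, h2⟩ := hAB
    obtain ⟨x, hxA, hxB⟩ := Finset.not_subset.1 h1
    obtain ⟨y, hyB, hyA⟩ := Finset.not_subset.1 h2
    obtain ⟨i, rfl⟩ := σ.surjective x
    obtain ⟨j, rfl⟩ := σ.surjective y
    rcases le_total i j with h | h
    · exact hxB (hmem B hB i j h hyB)
    · exact hyA (hmem A hA j i h hxA)
  have hcard := isPosetFree_fin_iff.1 hF _ (Finset.union_subset h1 h1') hchain
  have e1 := Finset.eq_of_subset_of_card_le (Finset.subset_union_left (s₁ := G) (s₂ := G'))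
    (by omega)
  have e2 := Finset.eq_of_subset_of_card_le (Finset.subset_union_right (s₁ := G) (s₂ := G'))
    (by omega)
  rw [e1, ← e2]

theorem La_le_maxMultinomial (n q : ℕ) : La n (Fin (q + 1)) (Fin q) ≤ maxMultinomial n q :=
  La_le fun F hF => by
    rw [copyCount_fin]
    exact card_chainsOf_le_maxMultinomial hF

end Multinomial

/-! ### Unions of levels with many chains. -/

section LevelFamilies

variable {n q : ℕ}

/-- The points that `g` sends below `i`. -/
def cut (g : Fin n → Fin (q + 1)) (i : ℕ) : Finset (Fin n) :=
  Finset.univ.filter fun x => (g x : ℕ) < i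

theorem mem_cut {g : Fin n → Fin (q + 1)} {i : ℕ} {x : Fin n} : x ∈ cut g i ↔ (g x : ℕ) < i := by
  simp [cut]

theorem cut_mono (g : Fin n → Fin (q + 1)) : Monotone (cut g) := by
  intro i j h x hx
  rw [mem_cut] at hx ⊢
  omega

theorem card_cut_comp (g : Fin n → Fin (q + 1)) (τ : Equiv.Perm (Fin n)) (i : ℕ) :
    (cut (g ∘ τ) i).card = (cut g i).card :=
  Finset.card_equiv τ fun x => by simp [mem_cut]

theorem card_cut_append {c : ℕ} (g : Fin n → Fin (q + 1)) (p : Fin c → Fin (q + 1)) (i : ℕ) :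
    (cut (Fin.append g p) i).card = (cut g i).card + (cut p i).card := by
  simp only [cut, Finset.card_filter, Fin.sum_univ_add, Fin.append_left, Fin.append_right]

/-- The function on pinned points which takes the values `0, …, q` in order and then stays at
`q`. -/
def pinned (q c : ℕ) (j : Fin c) : Fin (q + 1) := ⟨min j q, by omega⟩

/-- The initial segment of `[n]` that omits the last `j` points. -/
def dropLast (n j : ℕ) : Finset (Fin n) := Finset.univ.filter fun x => (x : ℕ) < n - j

theorem mem_dropLast {j : ℕ} {x : Fin n} : x ∈ dropLast n j ↔ (x : ℕ) < n - j := by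
  simp [dropLast]

theorem card_dropLast (n j : ℕ) : (dropLast n j).card = n - j := by
  have h := Fin.card_filter_val_lt (n := n) (m := n - j)
  rw [min_eq_right (Nat.sub_le n j)] at h
  rw [← h, dropLast]

/-- The pinned point with index `i` has value `i`, hence separates the two cuts. -/
theorem cut_append_pinned_ssubset (m : ℕ) (g : Fin n → Fin (q + 1)) {i j : ℕ} (hij : i < j)
    (hj : j ≤ q) : cut (Fin.append g (pinned q (q + 1 + m))) i ⊂
      cut (Fin.append g (pinned q (q + 1 + m))) j := by
  refine (Finset.ssubset_iff_of_subset (cut_mono _ hij.le)).2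
    ⟨Fin.natAdd n ⟨i, by omega⟩, ?_, ?_⟩ <;>
  · simp only [mem_cut, Fin.append_right, pinned]
    omega

theorem cut_append_pinned_ssubset_dropLast (m : ℕ) (g : Fin n → Fin (q + 1)) {i j : ℕ}
    (hi : i ≤ q) (hj : j < m) : cut (Fin.append g (pinned q (q + 1 + m))) i ⊂
      dropLast (n + (q + 1 + m)) j := by
  refine (Finset.ssubset_iff_of_subset fun x hx => ?_).2 ⟨Fin.natAdd n ⟨q, by omega⟩, ?_, ?_⟩
  · rw [mem_dropLast]
    induction x using Fin.addCases with
    | left x =>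
      simp only [Fin.val_castAdd]
      omega
    | right x =>
      simp only [mem_cut, Fin.append_right, pinned] at hx
      simp only [Fin.val_natAdd]
      omega
  · simp only [mem_dropLast, Fin.val_natAdd]
    omega
  · simp only [mem_cut, Fin.append_right, pinned]
    omega

/-- A family made of `q` levels and of `m` larger sets that has at least as many chains of `q + m`
members as the largest multinomial coefficient. -/
theorem exists_levels_union (n q m : ℕ) :
    ∃ L E : Finset (Finset (Fin (n + (q + 1 + m)))), IsPosetFree (Fin (q + 1)) L ∧ E.card ≤ m ∧
      (∀ A ∈ L, ∀ B ∈ E, ¬ B ⊆ A) ∧ maxMultinomial n q ≤ (chainsOf (q + m) (L ∪ E)).card := by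
  classical
  obtain ⟨g₀, hg₀⟩ := exists_fiberTypeCount_eq n q
  -- The pinned block makes every fiber nonempty, so the `q` cuts are distinct, and leaves `m`
  -- further points for the larger sets.
  let ext : (Fin n → Fin (q + 1)) → Fin (n + (q + 1 + m)) → Fin (q + 1) := fun g =>
    Fin.append g (pinned q (q + 1 + m))
  let s : ℕ → ℕ := fun i => (cut (ext g₀) i).card
  let T := Finset.univ.filter fun g : Fin n → Fin (q + 1) =>
    ∀ j, (Finset.univ.filter fun x => g x = j).card = (Finset.univ.filter fun x => g₀ x = j).card
  have hs : ∀ g ∈ T, ∀ i, (cut (ext g) i).card = s i := by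
    intro g hg i
    obtain ⟨τ, rfl⟩ := exists_perm_of_card_fiber_eq (Finset.mem_filter.1 hg).2
    simp only [ext, s, card_cut_append, card_cut_comp]
  have hs_inj : ∀ i ≤ q, ∀ j ≤ q, s i = s j → i = j := by
    intro i hi j hj h
    rcases lt_trichotomy i j with hij | hij | hij
    · exact absurd h (Finset.card_lt_card (cut_append_pinned_ssubset m g₀ hij hj)).ne
    · exact hij
    · exact absurd h (Finset.card_lt_card (cut_append_pinned_ssubset m g₀ hij hi)).ne'
  have hs_lt : ∀ i ≤ q, ∀ j < m, s i < (dropLast (n + (q + 1 + m)) j).card := fun i hi j hj =>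
    Finset.card_lt_card (cut_append_pinned_ssubset_dropLast m g₀ hi hj)
  let L : Finset (Finset (Fin (n + (q + 1 + m)))) :=
    Finset.univ.filter fun A => A.card ∈ (Finset.Icc 1 q).image s
  let E : Finset (Finset (Fin (n + (q + 1 + m)))) :=
    (Finset.range m).image (dropLast (n + (q + 1 + m)))
  have hLE : ∀ A ∈ L, ∀ B ∈ E, A.card < B.card := by
    intro A hA B hB
    obtain ⟨i, hi, hiA⟩ := Finset.mem_image.1 (Finset.mem_filter.1 hA).2
    obtain ⟨j, hj, rfl⟩ := Finset.mem_image.1 hB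
    rw [← hiA]
    exact hs_lt i (Finset.mem_Icc.1 hi).2 j (Finset.mem_range.1 hj)
  refine ⟨L, E, ?_, Finset.card_image_le.trans (by simp), fun A hA B hB h =>
    absurd (Finset.card_le_card h) (not_le.2 (hLE A hA B hB)), ?_⟩
  · refine isPosetFree_fin_iff.2 fun G hG hc => ?_
    have hinj : Set.InjOn Finset.card (G : Set (Finset (Fin (n + (q + 1 + m))))) := by
      intro A hA B hB h
      rcases hc.total hA hB with h' | h'
      · exact Finset.eq_of_subset_of_card_le h' h.ge
      · exact (Finset.eq_of_subset_of_card_le h' h.le).symm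
    rw [← Finset.card_image_of_injOn hinj]
    have h1 : (G.image Finset.card).card ≤ ((Finset.Icc 1 q).image s).card :=
      Finset.card_le_card fun i hi => by
        obtain ⟨A, hA, rfl⟩ := Finset.mem_image.1 hi
        exact (Finset.mem_filter.1 (hG hA)).2
    have h2 : ((Finset.Icc 1 q).image s).card ≤ (Finset.Icc 1 q).card := Finset.card_image_le
    rw [Nat.card_Icc] at h2
    omega
  · rw [← hg₀]
    show T.card ≤ _
    have hcutL : ∀ g ∈ T, (Finset.Icc 1 q).image (cut (ext g)) ⊆ L := by
      intro g hg A hA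
      obtain ⟨i, hi, rfl⟩ := Finset.mem_image.1 hA
      refine Finset.mem_filter.2 ⟨Finset.mem_univ _, ?_⟩
      rw [hs g hg]
      exact Finset.mem_image_of_mem s hi
    -- A function `g` goes to the chain of its cuts together with `E`. The size of a set tells which
    -- cut it is, and the cuts at `1, …, q` recover `g`.
    refine Finset.card_le_card_of_injOn
      (fun g => (Finset.Icc 1 q).image (cut (ext g)) ∪ E) ?_ ?_
    · intro g hg
      have hg' : g ∈ T := hg
      refine mem_chainsOf.2 ⟨Finset.union_subset_union (hcutL g hg') subset_rfl, ?_, ?_⟩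
      · rw [Finset.card_union_of_disjoint, Finset.card_image_of_injOn,
          Finset.card_image_of_injOn]
        · simp
        · intro i hi j hj h
          have := congrArg Finset.card h
          simp only [card_dropLast] at this
          have h1 := Finset.mem_range.1 hi
          have h2 := Finset.mem_range.1 hj
          omega
        · intro i hi j hj h
          have := congrArg Finset.card h
          rw [hs g hg', hs g hg'] at this
          exact hs_inj i (Finset.mem_Icc.1 hi).2 j (Finset.mem_Icc.1 hj).2 this
        · rw [Finset.disjoint_left]
          intro A hA hB
          exact lt_irrefl _ (hLE A (hcutL g hg' hA) A hB)
      · intro A hA B hB _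
        rcases Finset.mem_union.1 hA with hA | hA <;> rcases Finset.mem_union.1 hB with hB | hB <;>
          obtain ⟨i, hi, rfl⟩ := Finset.mem_image.1 hA <;>
          obtain ⟨j, hj, rfl⟩ := Finset.mem_image.1 hB
        · exact (le_total i j).imp (fun h => cut_mono _ h) (fun h => cut_mono _ h)
        · exact Or.inl (cut_append_pinned_ssubset_dropLast m g (Finset.mem_Icc.1 hi).2
            (Finset.mem_range.1 hj)).subset
        · exact Or.inr (cut_append_pinned_ssubset_dropLast m g (Finset.mem_Icc.1 hj).2
            (Finset.mem_range.1 hi)).subset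
        · refine (le_total i j).symm.imp (fun h x hx => ?_) (fun h x hx => ?_) <;>
          · rw [mem_dropLast] at hx ⊢
            omega
    · intro g hg g' hg' h
      have hcut : ∀ i ∈ Finset.Icc 1 q, cut (ext g) i = cut (ext g') i := by
        intro i hi
        have h1 : cut (ext g) i ∈ (Finset.Icc 1 q).image (cut (ext g')) ∪ E := by
          have h : (Finset.Icc 1 q).image (cut (ext g)) ∪ E =
            (Finset.Icc 1 q).image (cut (ext g')) ∪ E := h
          rw [← h]
          exact Finset.mem_union_left _ (Finset.mem_image_of_mem _ hi)
        rcases Finset.mem_union.1 h1 with h1 | h1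
        · obtain ⟨j, hj, hji⟩ := Finset.mem_image.1 h1
          have := congrArg Finset.card hji
          rw [hs g hg, hs g' hg'] at this
          rw [← hji, hs_inj j (Finset.mem_Icc.1 hj).2 i (Finset.mem_Icc.1 hi).2 this]
        · exact absurd (hLE _ (hcutL g hg (Finset.mem_image_of_mem _ hi)) _ h1) (lt_irrefl _)
      funext x
      have hx : ∀ i ∈ Finset.Icc 1 q, (g x : ℕ) < i ↔ (g' x : ℕ) < i := by
        intro i hi
        have := Finset.ext_iff.1 (hcut i hi) (Fin.castAdd _ x)
        simpa [mem_cut, ext, Fin.append_left] using this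
      have h1 := (g x).isLt
      have h2 := (g' x).isLt
      apply Fin.ext
      rcases lt_trichotomy (g x : ℕ) (g' x) with hlt | heq | hlt
      · have := (hx (g' x) (Finset.mem_Icc.2 ⟨by omega, by omega⟩)).1 hlt
        omega
      · exact heq
      · have := (hx (g x) (Finset.mem_Icc.2 ⟨by omega, by omega⟩)).2 hlt
        omega

/-- A lower bound for `La(n, P_{q+1}, P_q)` by the largest multinomial coefficient. -/
theorem maxMultinomial_le_La {n q : ℕ} (hn : q + 1 ≤ n) :
    maxMultinomial n q ≤ (q + 1) ^ (q + 1) * La n (Fin (q + 1)) (Fin q) := by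
  obtain ⟨n, rfl⟩ := Nat.exists_eq_add_of_le' hn
  refine (maxMultinomial_add_le n q (q + 1)).trans (Nat.mul_le_mul_left _ ?_)
  obtain ⟨L, E, hL, hE, -, hM⟩ := exists_levels_union n q 0
  have hE' : E = ∅ := Finset.card_eq_zero.1 (by omega)
  subst hE'
  rw [Finset.union_empty] at hM
  refine hM.trans ?_
  have := copyCount_le_La (Fin (q + 1)) (Fin q) hL
  rwa [copyCount_fin] at this

end LevelFamilies

/-! ### Counting chains in families without tall towers. -/

section Towers

variable {n : ℕ}

open Classical in
/-- The members of `F` that contain `B` strictly and are contained in `C`. -/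
noncomputable def between (F : Finset (Finset (Fin n))) (B C : Finset (Fin n)) :
    Finset (Finset (Fin n)) :=
  F.filter fun A => B ⊂ A ∧ A ⊆ C

theorem mem_between {F : Finset (Finset (Fin n))} {A B C : Finset (Fin n)} :
    A ∈ between F B C ↔ A ∈ F ∧ B ⊂ A ∧ A ⊆ C := by
  simp [between]

/-- `F` has `l` consecutive layers of at least `r` members each above `B`, separated by sets. -/
def HasTower (F : Finset (Finset (Fin n))) (r : ℕ) : ℕ → Finset (Fin n) → Prop
  | 0, _ => True
  | l + 1, B => ∃ C, r ≤ (between F B C).card ∧ HasTower F r l C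

theorem HasTower.exists_layers {F : Finset (Finset (Fin n))} {r l : ℕ} {B : Finset (Fin n)}
    (h : HasTower F r l B) : ∃ e : ℕ → Fin r → Finset (Fin n),
      (∀ i < l, ∀ a, e i a ∈ F ∧ B ⊂ e i a) ∧ (∀ i < l, Function.Injective (e i)) ∧
      ∀ i j, i < j → j < l → ∀ a b, e i a ⊂ e j b := by
  induction l generalizing B with
  | zero => exact ⟨fun _ _ => ∅, by simp, by simp, by simp⟩
  | succ l ih =>
    obtain ⟨C, hC, ht⟩ := h
    obtain ⟨e, he1, he2, he3⟩ := ih ht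
    obtain ⟨ι⟩ : Nonempty (Fin r ↪ {A // A ∈ between F B C}) :=
      Function.Embedding.nonempty_of_card_le (by simpa using hC)
    have hι : ∀ a, (ι a).1 ∈ F ∧ B ⊂ (ι a).1 ∧ (ι a).1 ⊆ C := fun a => mem_between.1 (ι a).2
    refine ⟨fun i => Nat.casesOn i (fun a => (ι a).1) e, ?_, ?_, ?_⟩
    · rintro (_ | i) hi a
      · exact ⟨(hι a).1, (hι a).2.1⟩
      · have := he1 i (by omega) a
        exact ⟨this.1, ((hι a).2.1.trans_subset (hι a).2.2).trans this.2⟩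
    · rintro (_ | i) hi
      · exact Subtype.val_injective.comp ι.injective
      · exact he2 i (by omega)
    · rintro (_ | i) (_ | j) hij hj a b
      · omega
      · exact (hι a).2.2.trans_ssubset (he1 j (by omega) b).2
      · omega
      · exact he3 i j (by omega) (by omega) a b

theorem IsPosetFree.not_hasTower {P : Type*} [PartialOrder P] [Fintype P] {l : ℕ}
    (hP : HasHeight P l) {F : Finset (Finset (Fin n))} (hF : IsPosetFree P F)
    (B : Finset (Fin n)) : ¬ HasTower F (Fintype.card P) l B := by
  intro h
  obtain ⟨e, he1, he2, he3⟩ := h.exists_layers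
  obtain ⟨f, hf, hfl⟩ := exists_rank (α := P) (l := l) fun c hc => hP.card_le hc
  let ι := Fintype.equivFin P
  -- The rank of `x` selects the layer, and an enumeration of `P` selects a position in it that no
  -- other element uses.
  refine isPosetFree_iff.1 hF (fun x => e (f x) (ι x)) ?_ ?_ fun x => (he1 _ (hfl x) _).1
  · intro x y hxy
    have hxy : e (f x) (ι x) = e (f y) (ι y) := hxy
    rcases lt_trichotomy (f x) (f y) with h | h | h
    · exact absurd hxy (he3 _ _ h (hfl y) _ _).ne
    · rw [h] at hxy
      exact ι.injective (he2 _ (hfl y) hxy)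
    · exact absurd hxy (he3 _ _ h (hfl x) _ _).ne'
  · intro x y hxy
    rcases hxy.eq_or_lt with rfl | h
    · exact subset_rfl
    · exact (he3 _ _ (hf h) (hfl y) _ _).subset

/-- Every chain above `B` is split by a covering pair `C \ {x} ⊂ C` at the place where the number
of members of `F` between `B` and the running set reaches `r`. -/
theorem exists_splitting_pair {F G : Finset (Finset (Fin n))} {B : Finset (Fin n)} {r : ℕ}
    (hr : 0 < r) (hG : IsChain (· ⊆ ·) (G : Set (Finset (Fin n)))) (hB : ∀ A ∈ G, B ⊂ A)
    (hF : r ≤ (between F B Finset.univ).card) :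
    ∃ C x, B ⊆ C ∧ r ≤ (between F B C).card ∧ (between F B (C.erase x)).card < r ∧
      ∀ A ∈ G, A ⊆ C.erase x ∨ A = C ∨ C ⊂ A := by
  classical
  -- Take a smallest set `C` that is comparable with all of `G` and has `r` members of `F` between
  -- it and `B`.
  let S := Finset.univ.filter fun C : Finset (Fin n) =>
    B ⊆ C ∧ r ≤ (between F B C).card ∧ ∀ A ∈ G, A ⊆ C ∨ C ⊆ A
  obtain ⟨C, hC, hmin⟩ := Finset.exists_min_image S Finset.card
    ⟨Finset.univ, by simp [S, hF]⟩
  obtain ⟨hBC, hrC, hGC⟩ := (Finset.mem_filter.1 hC).2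
  have hBC' : B ⊂ C := by
    obtain ⟨A, hA⟩ := Finset.card_pos.1 (hr.trans_le hrC)
    obtain ⟨-, h1, h2⟩ := mem_between.1 hA
    exact h1.trans_subset h2
  -- `D` is the last set among `B` and the chain strictly below `C`. Removing a point of `C \ D`
  -- preserves comparability, so minimality of `C` pushes the count below `r`.
  obtain ⟨D, hD, hmax⟩ := Finset.exists_max_image (insert B (G.filter fun A => A ⊂ C)) Finset.card
    ⟨B, Finset.mem_insert_self _ _⟩
  have hDC : D ⊂ C := by
    rcases Finset.mem_insert.1 hD with rfl | h
    · exact hBC'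
    · exact (Finset.mem_filter.1 h).2
  have hBD : B ⊆ D := by
    rcases Finset.mem_insert.1 hD with rfl | h
    · exact subset_rfl
    · exact (hB D (Finset.mem_filter.1 h).1).subset
  have hlow : ∀ A ∈ G, A ⊂ C → A ⊆ D := by
    intro A hA hAC
    have hle := hmax A (Finset.mem_insert_of_mem (Finset.mem_filter.2 ⟨hA, hAC⟩))
    rcases Finset.mem_insert.1 hD with rfl | h
    · exact absurd (Finset.card_lt_card (hB A hA)) (not_lt.2 hle)
    · rcases hG.total hA (Finset.mem_filter.1 h).1 with h' | h'
      · exact h'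
      · exact (Finset.eq_of_subset_of_card_le h' hle).ge
  obtain ⟨x, hxC, hxD⟩ := Finset.exists_of_ssubset hDC
  have hDx : D ⊆ C.erase x := Finset.subset_erase.2 ⟨hDC.subset, hxD⟩
  have hGx : ∀ A ∈ G, A ⊆ C.erase x ∨ A = C ∨ C ⊂ A := by
    intro A hA
    by_cases hAC : A = C
    · exact Or.inr (Or.inl hAC)
    · rcases hGC A hA with h | h
      · exact Or.inl ((hlow A hA (h.ssubset_of_ne hAC)).trans hDx)
      · exact Or.inr (Or.inr (h.ssubset_of_ne (Ne.symm hAC)))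
  refine ⟨C, x, hBC, hrC, ?_, hGx⟩
  by_contra! hlt
  have hmem : C.erase x ∈ S := by
    refine Finset.mem_filter.2 ⟨Finset.mem_univ _, hBD.trans hDx, hlt, fun A hA => ?_⟩
    rcases hGx A hA with h | rfl | h
    · exact Or.inl h
    · exact Or.inr (Finset.erase_subset _ _)
    · exact Or.inr ((Finset.erase_subset _ _).trans h.subset)
  exact absurd (hmin _ hmem) (not_le.2 (Finset.card_erase_lt_of_mem hxC))

open Classical in
/-- The chains in `F` all of whose members contain `B` strictly. -/
noncomputable def chainsAbove (F : Finset (Finset (Fin n))) (B : Finset (Fin n)) :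
    Finset (Finset (Finset (Fin n))) :=
  F.powerset.filter fun G => IsChain (· ⊆ ·) (G : Set (Finset (Fin n))) ∧ ∀ A ∈ G, B ⊂ A

theorem mem_chainsAbove {F G : Finset (Finset (Fin n))} {B : Finset (Fin n)} :
    G ∈ chainsAbove F B ↔
      G ⊆ F ∧ IsChain (· ⊆ ·) (G : Set (Finset (Fin n))) ∧ ∀ A ∈ G, B ⊂ A := by
  simp [chainsAbove]

theorem card_chainsAbove_le_of_between {F : Finset (Finset (Fin n))} {B : Finset (Fin n)} {r : ℕ}
    (h : (between F B Finset.univ).card < r) : (chainsAbove F B).card ≤ 2 ^ r := by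
  have hsub : chainsAbove F B ⊆ (between F B Finset.univ).powerset := by
    intro G hG
    obtain ⟨h1, -, h3⟩ := mem_chainsAbove.1 hG
    exact Finset.mem_powerset.2 fun A hA =>
      mem_between.2 ⟨h1 hA, h3 A hA, Finset.subset_univ _⟩
  refine (Finset.card_le_card hsub).trans ?_
  rw [Finset.card_powerset]
  exact Nat.pow_le_pow_right (by norm_num) h.le

/-- The binomial theorem, summed over the subsets of `Bᶜ`. -/
theorem sum_pow_card_compl (B : Finset (Fin n)) (a : ℕ) :
    ∑ C ∈ Finset.univ.filter (fun C => B ⊆ C), a ^ (Cᶜ).card = (a + 1) ^ (Bᶜ).card := by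
  rw [← Finset.sum_pow_mul_eq_add_pow]
  refine Finset.sum_nbij' compl compl ?_ ?_ ?_ ?_ ?_
  · intro C hC
    simpa using hC
  · intro C hC
    simpa [Finset.subset_compl_comm] using hC
  · simp
  · simp
  · simp

/-- Induct on `q` by splitting each chain at a pair `(C, x)`. There are at most `2^r` choices below,
two for whether `C` occurs, and the induction hypothesis counts the part above `C`, where one layer
fewer is forbidden. There are `n` choices of `x`, and the sum over `C ⊇ B` raises the base from `q`
to `q + 1`. -/
theorem card_chainsAbove_le {F : Finset (Finset (Fin n))} {r : ℕ} (hn : 0 < n) (hr : 0 < r) :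
    ∀ (q : ℕ) (B : Finset (Fin n)), ¬ HasTower F r (q + 1) B →
      (chainsAbove F B).card ≤ (2 ^ (r + 1) * n) ^ q * 2 ^ r * (q + 1) ^ (Bᶜ).card := by
  classical
  intro q
  induction q with
  | zero =>
    intro B hB
    simp only [pow_zero, one_mul, zero_add, one_pow, mul_one]
    refine card_chainsAbove_le_of_between ?_
    by_contra! h
    exact hB ⟨Finset.univ, h, trivial⟩
  | succ q ih =>
    intro B hB
    rcases lt_or_ge (between F B Finset.univ).card r with h | h
    · refine (card_chainsAbove_le_of_between h).trans ?_
      rw [mul_right_comm]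
      exact Nat.le_mul_of_pos_left _ (by positivity)
    let pairs := (Finset.univ.filter (fun C : Finset (Fin n) => B ⊆ C)) ×ˢ
      (Finset.univ : Finset (Fin n))
    let piece : Finset (Fin n) × Fin n → Finset (Finset (Finset (Fin n))) := fun p =>
      if r ≤ (between F B p.1).card ∧ (between F B (p.1.erase p.2)).card < r then
        ((between F B (p.1.erase p.2)).powerset ×ˢ ({p.1} : Finset (Finset (Fin n))).powerset ×ˢ
          chainsAbove F p.1).image fun t => t.1 ∪ (t.2.1 ∪ t.2.2)
      else ∅
    have hcover : chainsAbove F B ⊆ pairs.biUnion piece := by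
      intro G hG
      obtain ⟨h1, h2, h3⟩ := mem_chainsAbove.1 hG
      obtain ⟨C, x, hBC, hC1, hC2, hGC⟩ := exists_splitting_pair hr h2 h3 h
      refine Finset.mem_biUnion.2 ⟨(C, x), by simp [pairs, hBC], ?_⟩
      simp only [piece, hC1, hC2, and_self, if_true]
      refine Finset.mem_image.2 ⟨(G.filter fun A => A ⊆ C.erase x, G.filter fun A => A = C,
        G.filter fun A => C ⊂ A), ?_, ?_⟩
      · simp only [Finset.mem_product, Finset.mem_powerset]
        refine ⟨fun A hA => ?_, fun A hA => ?_, mem_chainsAbove.2 ⟨?_, ?_, ?_⟩⟩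
        · obtain ⟨hA, hAC⟩ := Finset.mem_filter.1 hA
          exact mem_between.2 ⟨h1 hA, h3 A hA, hAC⟩
        · exact Finset.mem_singleton.2 (Finset.mem_filter.1 hA).2
        · exact (Finset.filter_subset _ _).trans h1
        · exact h2.mono (by exact_mod_cast Finset.filter_subset _ _)
        · intro A hA
          exact (Finset.mem_filter.1 hA).2
      · ext A
        simp only [Finset.mem_union, Finset.mem_filter]
        constructor
        · rintro (h | h | h) <;> exact h.1
        · intro hA
          rcases hGC A hA with h | h | h
          · exact Or.inl ⟨hA, h⟩
          · exact Or.inr (Or.inl ⟨hA, h⟩)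
          · exact Or.inr (Or.inr ⟨hA, h⟩)
    have hpiece : ∀ p ∈ pairs, (piece p).card ≤
        2 ^ (r + 1) * ((2 ^ (r + 1) * n) ^ q * 2 ^ r) * (q + 1) ^ (p.1ᶜ).card := by
      intro p _
      simp only [piece]
      split_ifs with hp
      · refine Finset.card_image_le.trans ?_
        rw [Finset.card_product, Finset.card_product, Finset.card_powerset, Finset.card_powerset,
          Finset.card_singleton]
        have h1 : 2 ^ (between F B (p.1.erase p.2)).card ≤ 2 ^ r :=
          Nat.pow_le_pow_right (by norm_num) hp.2.le
        have h2 := ih p.1 fun ht => hB ⟨p.1, hp.1, ht⟩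
        calc _ ≤ 2 ^ r * (2 ^ 1 * ((2 ^ (r + 1) * n) ^ q * 2 ^ r * (q + 1) ^ (p.1ᶜ).card)) :=
              Nat.mul_le_mul h1 (Nat.mul_le_mul_left _ h2)
          _ = _ := by ring
      · simp
    calc (chainsAbove F B).card ≤ (pairs.biUnion piece).card := Finset.card_le_card hcover
      _ ≤ ∑ p ∈ pairs, (piece p).card := Finset.card_biUnion_le
      _ ≤ ∑ p ∈ pairs, 2 ^ (r + 1) * ((2 ^ (r + 1) * n) ^ q * 2 ^ r) * (q + 1) ^ (p.1ᶜ).card :=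
          Finset.sum_le_sum hpiece
      _ = (2 ^ (r + 1) * n) ^ (q + 1) * 2 ^ r *
            ∑ C ∈ Finset.univ.filter (fun C => B ⊆ C), (q + 1) ^ (Cᶜ).card := by
          rw [Finset.sum_product, Finset.mul_sum]
          refine Finset.sum_congr rfl fun C _ => ?_
          simp only [Finset.sum_const, Finset.card_univ, Fintype.card_fin, smul_eq_mul]
          ring
      _ = _ := by rw [sum_pow_card_compl]

/-- The factor `2` records whether `∅` belongs to the chain, since `chainsAbove F ∅` excludes it. -/
theorem card_chainsOf_le_two_mul (k : ℕ) (F : Finset (Finset (Fin n))) :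
    (chainsOf k F).card ≤ 2 * (chainsAbove F ∅).card := by
  classical
  have hcover : chainsOf k F ⊆ (({∅} : Finset (Finset (Fin n))).powerset ×ˢ chainsAbove F ∅).image
      fun t => t.1 ∪ t.2 := by
    intro G hG
    obtain ⟨h1, -, h3⟩ := mem_chainsOf.1 hG
    refine Finset.mem_image.2 ⟨(G.filter fun A => A = ∅, G.filter fun A => ¬ A = ∅), ?_,
      Finset.filter_union_filter_not_eq _ _⟩
    refine Finset.mem_product.2 ⟨Finset.mem_powerset.2 fun A hA => ?_, mem_chainsAbove.2
      ⟨(Finset.filter_subset _ _).trans h1, ?_, fun A hA => ?_⟩⟩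
    · exact Finset.mem_singleton.2 (Finset.mem_filter.1 hA).2
    · exact h3.mono (by exact_mod_cast Finset.filter_subset _ _)
    · exact Finset.empty_ssubset.2 (Finset.nonempty_iff_ne_empty.2 (Finset.mem_filter.1 hA).2)
  refine (Finset.card_le_card hcover).trans (Finset.card_image_le.trans ?_)
  simp

/-- A poset-free family has few chains, in terms of the height of the poset. -/
theorem La_le_of_hasHeight {P : Type*} [PartialOrder P] [Fintype P] [Nonempty P] {q : ℕ}
    (hP : HasHeight P (q + 1)) (k : ℕ) (hn : 0 < n) :
    La n P (Fin k) ≤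
      2 * ((2 ^ (Fintype.card P + 1) * n) ^ q * 2 ^ Fintype.card P * (q + 1) ^ n) := by
  refine La_le fun F hF => ?_
  rw [copyCount_fin]
  refine (card_chainsOf_le_two_mul k F).trans (Nat.mul_le_mul_left _ ?_)
  simpa using card_chainsAbove_le hn Fintype.card_pos q ∅ (hF.not_hasTower hP ∅)

end Towers

/-! ### Brooms, which attain the lower order of magnitude. -/

section Broom

/-- The poset formed by a chain of `q` elements below an antichain of `r` elements. -/
def Broom (q r : ℕ) : Type := Fin q ⊕ Fin r

namespace Broom

variable {q r : ℕ}

/-- The level of an element of the broom. -/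
def rank : Broom q r → ℕ := Sum.elim (fun i => (i : ℕ)) fun _ => q

instance : Fintype (Broom q r) := inferInstanceAs (Fintype (Fin q ⊕ Fin r))

instance : PartialOrder (Broom q r) where
  le x y := x = y ∨ rank x < rank y
  le_refl x := Or.inl rfl
  le_trans := by
    rintro x y z (rfl | h) (rfl | h')
    · exact Or.inl rfl
    · exact Or.inr h'
    · exact Or.inr h
    · exact Or.inr (h.trans h')
  le_antisymm := by
    rintro x y (rfl | h) (h' | h')
    · rfl
    · rfl
    · exact h'.symm
    · omega

/-- An element of the handle. -/
def handle (i : Fin q) : Broom q r := Sum.inl i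

/-- A maximal element. -/
def bristle (j : Fin r) : Broom q r := Sum.inr j

theorem handle_le_bristle (i : Fin q) (j : Fin r) : (handle i : Broom q r) ≤ bristle j :=
  Or.inr i.isLt

theorem handle_mono : Monotone (handle : Fin q → Broom q r) := by
  intro i j h
  rcases h.eq_or_lt with rfl | h
  · exact le_rfl
  · exact Or.inr h

theorem handle_injective : Function.Injective (handle : Fin q → Broom q r) := Sum.inl_injective

theorem bristle_injective : Function.Injective (bristle : Fin r → Broom q r) := Sum.inr_injective

theorem exists_spine (j : Fin r) : ∃ c : Finset (Broom q r), c.card = q + 1 ∧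
    IsChain (· ≤ ·) (c : Set (Broom q r)) ∧ ∀ x ∈ c, x ≤ bristle j := by
  classical
  refine ⟨insert (bristle j) (Finset.univ.image handle), ?_, ?_, ?_⟩
  · rw [Finset.card_insert_of_notMem, Finset.card_image_of_injective _ handle_injective]
    · simp
    · intro h
      obtain ⟨i, -, h⟩ := Finset.mem_image.1 h
      exact absurd h Sum.inl_ne_inr
  · rw [Finset.coe_insert]
    refine IsChain.insert ?_ ?_
    · intro x hx y hy _
      obtain ⟨i, -, rfl⟩ := Finset.mem_image.1 hx
      obtain ⟨i', -, rfl⟩ := Finset.mem_image.1 hy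
      exact (le_total i i').imp (fun h => handle_mono h) (fun h => handle_mono h)
    · intro x hx _
      obtain ⟨i, -, rfl⟩ := Finset.mem_image.1 hx
      exact Or.inr (handle_le_bristle i j)
  · intro x hx
    rcases Finset.mem_insert.1 hx with rfl | hx
    · exact le_rfl
    · obtain ⟨i, -, rfl⟩ := Finset.mem_image.1 hx
      exact handle_le_bristle i j

theorem hasHeight (q r : ℕ) : HasHeight (Broom q (r + 1)) (q + 1) := by
  classical
  obtain ⟨c, hc, hch, -⟩ := exists_spine (q := q) (0 : Fin (r + 1))
  refine hasHeight_of (fun d hd => ?_) hch hc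
  have hinj : Set.InjOn rank (d : Set (Broom q (r + 1))) := by
    intro x hx y hy h
    rcases hd.total hx hy with (h' | h') | (h' | h')
    · exact h'
    · omega
    · exact h'.symm
    · omega
  have hle : ∀ x : Broom q (r + 1), rank x < q + 1 := by
    rintro (i | j)
    · exact i.isLt.trans (Nat.lt_succ_self q)
    · exact Nat.lt_succ_self q
  rw [← Finset.card_image_of_injOn hinj, ← Finset.card_range (q + 1)]
  refine Finset.card_le_card fun i hi => ?_
  obtain ⟨x, -, rfl⟩ := Finset.mem_image.1 hi
  exact Finset.mem_range.2 (hle x)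

end Broom

variable {n : ℕ}

/-- A `q`-chain with `r` members of `F` above it would form a broom. A longer chain is its lowest
`q` members plus a subset of the members above them. -/
theorem card_chainsOf_le_of_broom {q m r : ℕ} {F : Finset (Finset (Fin n))}
    (hF : IsPosetFree (Broom q r) F) :
    (chainsOf (q + m) F).card ≤ 2 ^ r * (chainsOf q F).card := by
  classical
  let above : Finset (Finset (Fin n)) → Finset (Finset (Fin n)) := fun G =>
    F.filter fun B => ∀ A ∈ G, A ⊂ B
  have habove : ∀ G ∈ chainsOf q F, (above G).card ≤ r := by
    intro G hG
    obtain ⟨h1, h2, h3⟩ := mem_chainsOf.1 hG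
    by_contra! hlt
    obtain ⟨φ, hi, hm, hr⟩ := exists_monotone_enum h2 h3
    have hφ : ∀ i, φ i ∈ G := fun i => by
      have : φ i ∈ (G : Set (Finset (Fin n))) := hr ▸ Set.mem_range_self i
      exact this
    obtain ⟨ι⟩ : Nonempty (Fin r ↪ {A // A ∈ above G}) :=
      Function.Embedding.nonempty_of_card_le (by simpa using hlt.le)
    have hι : ∀ j, (ι j).1 ∈ F ∧ ∀ A ∈ G, A ⊂ (ι j).1 := fun j =>
      Finset.mem_filter.1 (ι j).2
    refine isPosetFree_iff.1 hF (Sum.elim φ fun j => (ι j).1) ?_ ?_ ?_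
    · exact Function.Injective.sumElim hi (Subtype.val_injective.comp ι.injective)
        fun i j => ((hι j).2 _ (hφ i)).ne
    · rintro (i | i) (j | j) (h | h)
      · rw [h]
      · exact hm (le_of_lt h)
      · exact absurd h Sum.inl_ne_inr
      · exact ((hι j).2 _ (hφ i)).subset
      · exact absurd h Sum.inr_ne_inl
      · exact absurd (show q < j from h) (by omega)
      · rw [h]
      · exact absurd (show q < q from h) (lt_irrefl _)
    · rintro (i | j)
      · exact h1 (hφ i)
      · exact (hι j).1
  have hcover : chainsOf (q + m) F ⊆ (chainsOf q F).biUnion fun G =>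
      (above G).powerset.image fun H => G ∪ H := by
    intro K hK
    obtain ⟨h1, h2, h3⟩ := mem_chainsOf.1 hK
    obtain ⟨φ, hi, hm, hr⟩ := exists_monotone_enum h2 h3
    have hφ : ∀ i, φ i ∈ K := fun i => by
      have : φ i ∈ (K : Set (Finset (Fin n))) := hr ▸ Set.mem_range_self i
      exact this
    have hlow : (Finset.univ.image fun i : Fin q => φ (Fin.castAdd m i)) ⊆ K := by
      intro A hA
      obtain ⟨i, -, rfl⟩ := Finset.mem_image.1 hA
      exact hφ _
    refine Finset.mem_biUnion.2 ⟨Finset.univ.image fun i : Fin q => φ (Fin.castAdd m i), ?_, ?_⟩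
    · refine mem_chainsOf.2 ⟨hlow.trans h1, ?_, h3.mono (by exact_mod_cast hlow)⟩
      exact (Finset.card_image_of_injective _ (hi.comp (Fin.castAdd_injective q m))).trans (by simp)
    · refine Finset.mem_image.2 ⟨Finset.univ.image fun j : Fin m => φ (Fin.natAdd q j), ?_, ?_⟩
      · refine Finset.mem_powerset.2 fun B hB => ?_
        obtain ⟨j, -, rfl⟩ := Finset.mem_image.1 hB
        refine Finset.mem_filter.2 ⟨h1 (hφ _), fun A hA => ?_⟩
        obtain ⟨i, -, rfl⟩ := Finset.mem_image.1 hA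
        have hlt : Fin.castAdd m i < Fin.natAdd q j := by
          rw [Fin.lt_def, Fin.val_castAdd, Fin.val_natAdd]
          omega
        exact (hm hlt.le).ssubset_of_ne fun h => hlt.ne (hi h)
      · ext A
        simp only [Finset.mem_union, Finset.mem_image, Finset.mem_univ, true_and]
        constructor
        · rintro (⟨i, rfl⟩ | ⟨i, rfl⟩) <;> exact hφ _
        · intro hA
          have : A ∈ Set.range φ := by rw [hr]; exact hA
          obtain ⟨i, rfl⟩ := this
          induction i using Fin.addCases with
          | left i => exact Or.inl ⟨i, rfl⟩
          | right i => exact Or.inr ⟨i, rfl⟩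
  refine (Finset.card_le_card hcover).trans ?_
  rw [mul_comm]
  refine Finset.card_biUnion_le_card_mul _ _ _ fun G hG => Finset.card_image_le.trans ?_
  rw [Finset.card_powerset]
  exact Nat.pow_le_pow_right (by norm_num) (habove G hG)

theorem La_broom_le (n q m r : ℕ) :
    La n (Broom q r) (Fin (q + m)) ≤ 2 ^ r * (Fintype.card (Broom q r) - 1).choose q *
      La n (Fin (q + 1)) (Fin q) := by
  refine La_le fun F hF => ?_
  rw [copyCount_fin, mul_assoc]
  exact (card_chainsOf_le_of_broom hF).trans
    (Nat.mul_le_mul_left _ (card_chainsOf_le _ _ hF.fin_card))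

/-- With `m + 1` bristles and at most `m` sets in `E`, some bristle lands in `L`. Everything below
it then lands in `L` too, giving a chain of `q + 1` sets there. -/
theorem isPosetFree_broom_union {q m : ℕ} {L E : Finset (Finset (Fin n))}
    (hL : IsPosetFree (Fin (q + 1)) L) (hE : E.card ≤ m) (hLE : ∀ A ∈ L, ∀ B ∈ E, ¬ B ⊆ A) :
    IsPosetFree (Broom q (m + 1)) (L ∪ E) := by
  classical
  refine isPosetFree_iff.2 fun φ hi hm hφ => ?_
  have hφ' : ∀ x, φ x ∈ L ∨ φ x ∈ E := fun x => Finset.mem_union.1 (hφ x)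
  obtain ⟨j, hj⟩ : ∃ j : Fin (m + 1), φ (Broom.bristle j) ∈ L := by
    by_contra! h
    have := Finset.card_le_card_of_injOn (s := (Finset.univ : Finset (Fin (m + 1)))) (t := E)
      (fun j => φ (Broom.bristle j)) (fun j _ => (hφ' _).resolve_left (h j))
      (hi.comp Broom.bristle_injective).injOn
    simp at this
    omega
  obtain ⟨c, hc, hch, hcj⟩ := Broom.exists_spine (q := q) j
  have := isPosetFree_fin_iff.1 hL (c.image φ) (by
    intro A hA
    obtain ⟨x, hx, rfl⟩ := Finset.mem_image.1 hA
    exact (hφ' x).resolve_right fun hxE => hLE _ hj _ hxE (hm (hcj x hx))) (by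
    rw [Finset.coe_image]
    rintro _ ⟨x, hx, rfl⟩ _ ⟨y, hy, rfl⟩ -
    exact (hch.total hx hy).imp (fun h => hm h) (fun h => hm h))
  rw [Finset.card_image_of_injective _ hi] at this
  omega

theorem La_le_La_broom {q m : ℕ} (hn : q + 1 + m ≤ n) :
    La n (Fin (q + 1)) (Fin q) ≤
      (q + 1) ^ (q + 1 + m) * La n (Broom q (m + 1)) (Fin (q + m)) := by
  obtain ⟨n, rfl⟩ := Nat.exists_eq_add_of_le' hn
  refine (La_le_maxMultinomial _ q).trans ((maxMultinomial_add_le n q _).trans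
    (Nat.mul_le_mul_left _ ?_))
  obtain ⟨L, E, hL, hE, hLE, hM⟩ := exists_levels_union n q m
  refine hM.trans ?_
  rw [← copyCount_fin]
  exact copyCount_le_La _ _ (isPosetFree_broom_union hL hE hLE)

end Broom

/-! ### Passing to asymptotic notation. -/

section Asymptotics

theorem isBigO_natCast {f g : ℕ → ℕ} (c : ℕ) (h : ∀ᶠ n in atTop, f n ≤ c * g n) :
    (fun n => (f n : ℝ)) =O[atTop] fun n => (g n : ℝ) := by
  refine IsBigO.of_bound (c : ℝ) (h.mono fun n hn => ?_)
  simp only [Real.norm_natCast]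
  exact_mod_cast hn

/-- The powers `(q + 1)^n` cancel. The splitting costs `n^q` and the pigeonhole `(n + 1)^(q + 1) ≤
(2n)^(q + 1)`, so the loss is `n^(2l - 1)`, within the stated exponent as `l ≤ k`. -/
theorem La_isBigO_of_hasHeight {P : Type*} [PartialOrder P] [Fintype P] [Nonempty P] {k l : ℕ}
    (hP : HasHeight P l) (hlk : l ≤ k) :
    (fun n : ℕ => (La n P (Fin k) : ℝ)) =O[atTop]
      (fun n : ℕ => (n : ℝ) ^ (2 * (k : ℝ) - 1 / 2) * (La n (Fin l) (Fin (l - 1)) : ℝ)) := by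
  obtain ⟨q, rfl⟩ : ∃ q, l = q + 1 := by
    refine Nat.exists_eq_succ_of_ne_zero fun h0 => ?_
    have := hP.card_le (c := {Classical.arbitrary P}) (by simp)
    simp [h0] at this
  rw [Nat.add_sub_cancel]
  set p := Fintype.card P
  let c : ℕ := 2 * (2 ^ (p + 1)) ^ q * 2 ^ p * 2 ^ (q + 1) * (q + 1) ^ (q + 1)
  have hle : ∀ᶠ n : ℕ in atTop, La n P (Fin k) ≤
      c * (n ^ (2 * q + 1) * La n (Fin (q + 1)) (Fin q)) := by
    filter_upwards [eventually_ge_atTop (q + 1)] with n hn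
    calc La n P (Fin k) ≤ 2 * ((2 ^ (p + 1) * n) ^ q * 2 ^ p * (q + 1) ^ n) :=
          La_le_of_hasHeight hP k (by omega)
      _ ≤ 2 * ((2 ^ (p + 1) * n) ^ q * 2 ^ p * ((2 * n) ^ (q + 1) *
            ((q + 1) ^ (q + 1) * La n (Fin (q + 1)) (Fin q)))) := by
          refine Nat.mul_le_mul_left _ (Nat.mul_le_mul_left _ ?_)
          refine (pow_le_maxMultinomial n q).trans (Nat.mul_le_mul ?_ (maxMultinomial_le_La hn))
          exact Nat.pow_le_pow_left (by omega) _
      _ = _ := by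
          simp only [c, mul_pow]
          ring
  refine (isBigO_natCast c hle).trans (IsBigO.of_bound 1 ?_)
  filter_upwards [eventually_ge_atTop 1] with n hn
  have hn' : (1 : ℝ) ≤ n := by exact_mod_cast hn
  rw [one_mul, Real.norm_natCast, norm_mul, Real.norm_natCast,
    Real.norm_of_nonneg (Real.rpow_nonneg (by positivity) _)]
  push_cast
  refine mul_le_mul_of_nonneg_right ?_ (by positivity)
  rw [← Real.rpow_natCast]
  refine Real.rpow_le_rpow_of_exponent_le hn' ?_
  have : ((q + 1 : ℕ) : ℝ) ≤ k := by exact_mod_cast hlk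
  push_cast at this ⊢
  linarith

end Asymptotics

/-- The path poset `P_m` is `Fin m`; in particular `Fin 0` is the empty poset, which has exactly
one copy (the empty subfamily) in every family. -/
theorem theorem1p4 (k l : ℕ) :
    (∀ (P : Type*) [PartialOrder P] [Fintype P] [Nonempty P], HasHeight P l →
      (k < l →
        (fun n : ℕ => (La n P (Fin k) : ℝ)) =Θ[atTop]
            (fun n : ℕ => (La n (Fin (k + 1)) (Fin k) : ℝ)) ∧
        ∀ n : ℕ,
          La n (Fin (k + 1)) (Fin k) ≤ La n P (Fin k) ∧
          La n P (Fin k) ≤ La n (Fin (Fintype.card P)) (Fin k) ∧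
          La n (Fin (Fintype.card P)) (Fin k) ≤
            (Fintype.card P - 1).choose k * La n (Fin (k + 1)) (Fin k)) ∧
      (l ≤ k →
        (fun n : ℕ => (La n P (Fin k) : ℝ)) =O[atTop]
          (fun n : ℕ => (n : ℝ) ^ (2 * (k : ℝ) - 1 / 2) * (La n (Fin l) (Fin (l - 1)) : ℝ)))) ∧
    (1 ≤ l → l ≤ k →
      ∃ (P : Type) (_ : PartialOrder P) (_ : Fintype P), HasHeight P l ∧
        (fun n : ℕ => (La n P (Fin k) : ℝ)) =Θ[atTop]
          (fun n : ℕ => (La n (Fin l) (Fin (l - 1)) : ℝ))) := by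
  refine ⟨fun P _ _ _ hP => ⟨fun hkl => ?_, fun hlk => La_isBigO_of_hasHeight hP hlk⟩,
    fun hl hlk => ?_⟩
  · have hbound : ∀ n : ℕ,
        La n (Fin (k + 1)) (Fin k) ≤ La n P (Fin k) ∧
        La n P (Fin k) ≤ La n (Fin (Fintype.card P)) (Fin k) ∧
        La n (Fin (Fintype.card P)) (Fin k) ≤
          (Fintype.card P - 1).choose k * La n (Fin (k + 1)) (Fin k) := fun n =>
      ⟨La_chain_le_La _ hP hkl, La_le_La_card _ _, La_fin_le _ _⟩
    refine ⟨⟨isBigO_natCast ((Fintype.card P - 1).choose k) (Eventually.of_forall fun n =>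
        (hbound n).2.1.trans (hbound n).2.2),
      isBigO_natCast 1 (Eventually.of_forall fun n => ?_)⟩, hbound⟩
    rw [one_mul]
    exact (hbound n).1
  · obtain ⟨q, rfl⟩ := Nat.exists_eq_add_of_le' hl
    -- Here `m = k - (l - 1)` is the number of sets that a `k`-chain has beyond its lowest `l - 1`;
    -- the broom gets `m + 1` bristles so that `m` large sets can be added.
    obtain ⟨m, rfl⟩ := Nat.exists_eq_add_of_le (Nat.le_of_succ_le hlk)
    refine ⟨Broom q (m + 1), inferInstance, inferInstance, Broom.hasHeight q m, ?_⟩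
    rw [Nat.add_sub_cancel]
    exact ⟨isBigO_natCast _ (Eventually.of_forall fun n => La_broom_le n q m (m + 1)),
      isBigO_natCast _ ((eventually_ge_atTop (q + 1 + m)).mono fun n hn => La_le_La_broom hn)⟩
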